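/- A digraph here is finite and may have loops and multiple arcs. A mixed graph $D=(V,A)$ is a digraph together with a partition $E(D)$ of its arc set $A$ into singletons (oriented edges) and doubletons made of two opposite arcs (unoriented edges). A complete orientation of $D$ is a digraph $\vec D$ obtained by choosing a direction for each unoriented edge, that is, by keeping exactly one arc of each doubleton (the two choices for an unoriented loop are counted as different); let $\mathrm{Ori}(D)$ denote the set of these choices. A digraph is totally cyclic if each of its arcs belongs to a directed cycle. Let $c(D)$ be the number of connected components of $D$. For a digraph $D=(V,A)$, let $B_D(q,y,z)$ be the unique polynomial such that, for every positive integer $q$, $$B_D(q,y,z)=\sum_{f:V\to\{1,\ldots,q\}}y^{\#\{(u,v)\in A\,:\,f(u)<f(v)\}}\,z^{\#\{(u,v)\in A\,:\,f(u)>f(v)\}},$$ where arcs are counted with multiplicity. For a mixed graph $D$ put $$T^{(2)}_D(x,y)=\frac{y^{|E(D)|}}{2^{|E(D)|}(y-1)^{|V|}(x-1)^{c(D)}}\sum_{\vec D\in \mathrm{Ori}(D)}B_{\vec D}\left((x-1)(y-1),\frac{2-y}{y},1\right).$$ Then, for every mixed graph $D$, the value of $T^{(2)}_D$ at $(x,y)=(0,2)$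 is $$T^{(2)}_D(0,2)=\#\{\text{totally cyclic complete orientations of } D\}.$$ -/

import Mathlib

/-- A directed graph on the vertex set `V` whose arcs are labelled by `A`; loops and multiple arcs
are allowed. -/
structure MultiDigraph (V A : Type*) where
  origin : A → V
  target : A → V

namespace MultiDigraph

variable {V A : Type*}

/-- The subdigraph with vertex set `V` that keeps exactly the arcs in `S`. -/
def restrict (D : MultiDigraph V A) (S : Finset A) : MultiDigraph V S where
  origin a := D.origin a
  target a := D.target a

/-- The number of ascents of a coloring `f`: arcs `(u, v)` with `f u < f v`. -/
def ascents [Fintype A] {C : Type*} [LinearOrder C] (D : MultiDigraph V A) (f : V → C) : ℕ :=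
  (Finset.univ.filter fun a => f (D.origin a) < f (D.target a)).card

/-- The number of descents of a coloring `f`: arcs `(u, v)` with `f v < f u`. -/
def descents [Fintype A] {C : Type*} [LinearOrder C] (D : MultiDigraph V A) (f : V → C) : ℕ :=
  (Finset.univ.filter fun a => f (D.target a) < f (D.origin a)).card

open Classical in
/-- The `B`-polynomial `B_D(q, y, z)` with `q = X 0`, `y = X 1`, `z = X 2`:
`∑ p, q (q - 1) ⋯ (q - p + 1) / p! * ∑ g, y ^ asc(g) * z ^ des(g)`, where `g` runs over the
surjections of `V` onto `p` linearly ordered colors. By `eval_bPoly` and `bPoly_unique` below, it is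
the unique polynomial that for every positive integer `q` is the generating function of the
`q`-colorings of `D` by ascents and descents. -/
noncomputable def bPoly [Fintype V] [Fintype A] (D : MultiDigraph V A) :
    MvPolynomial (Fin 3) ℚ :=
  ∑ p ∈ Finset.range (Fintype.card V + 1),
    MvPolynomial.C ((p.factorial : ℚ)⁻¹) *
      Polynomial.aeval (MvPolynomial.X 0 : MvPolynomial (Fin 3) ℚ) (descPochhammer ℚ p) *
      ∑ g ∈ (Finset.univ.filter fun g : V → Fin p => Function.Surjective g),
        MvPolynomial.X 1 ^ D.ascents g * MvPolynomial.X 2 ^ D.descents g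

lemma ascents_comp [Fintype A] {C C' : Type*} [LinearOrder C] [LinearOrder C']
    (D : MultiDigraph V A) (e : C ↪o C') (f : V → C) : D.ascents (e ∘ f) = D.ascents f := by
  simp [ascents]

lemma descents_comp [Fintype A] {C C' : Type*} [LinearOrder C] [LinearOrder C']
    (D : MultiDigraph V A) (e : C ↪o C') (f : V → C) : D.descents (e ∘ f) = D.descents f := by
  simp [descents]

open Classical in
/-- The `B`-polynomial counts `q`-colorings by ascents and descents. -/
theorem eval_bPoly [Fintype V] [Fintype A] (D : MultiDigraph V A) (q : ℕ) (y z : ℚ) :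
    MvPolynomial.eval ![(q : ℚ), y, z] D.bPoly =
      ∑ f : V → Fin q, y ^ D.ascents f * z ^ D.descents f := by
  set F : ℕ → ℚ := fun p => ∑ g ∈ (Finset.univ.filter fun g : V → Fin p => Function.Surjective g),
    y ^ D.ascents g * z ^ D.descents g with hF
  have hbin : ∀ p : ℕ, ((p.factorial : ℚ)⁻¹) * (descPochhammer ℚ p).eval (q : ℚ) = q.choose p := by
    intro p
    rw [descPochhammer_eval_eq_descFactorial, Nat.descFactorial_eq_factorial_mul_choose]
    push_cast
    field_simp
  have hpoly : ∀ p : ℕ, MvPolynomial.eval ![(q : ℚ), y, z]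
      (Polynomial.aeval (MvPolynomial.X 0 : MvPolynomial (Fin 3) ℚ) (descPochhammer ℚ p)) =
      (descPochhammer ℚ p).eval (q : ℚ) := by
    intro p
    have h := Polynomial.hom_eval₂ (descPochhammer ℚ p)
      (algebraMap ℚ (MvPolynomial (Fin 3) ℚ)) (MvPolynomial.eval ![(q : ℚ), y, z])
      (MvPolynomial.X 0)
    rw [Polynomial.aeval_def, h]
    have : (MvPolynomial.eval ![(q : ℚ), y, z]).comp (algebraMap ℚ (MvPolynomial (Fin 3) ℚ)) =
        RingHom.id ℚ := Subsingleton.elim _ _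
    rw [this]
    simp
  have hL : MvPolynomial.eval ![(q : ℚ), y, z] D.bPoly =
      ∑ p ∈ Finset.range (Fintype.card V + 1), (q.choose p : ℚ) * F p := by
    simp only [bPoly, map_sum, map_mul, map_pow, MvPolynomial.eval_C, MvPolynomial.eval_X, hpoly,
      hbin, hF]
    rfl
  have hfib : ∀ s : Finset (Fin q),
      (∑ f ∈ (Finset.univ.filter fun f : V → Fin q => Finset.univ.image f = s),
        y ^ D.ascents f * z ^ D.descents f) = F s.card := by
    intro s
    symm
    refine Finset.sum_bij (fun g _ => s.orderEmbOfFin rfl ∘ g) ?_ ?_ ?_ ?_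
    · intro g hg
      have hg' : Function.Surjective g := by simpa using hg
      simp only [Finset.mem_filter, Finset.mem_univ, true_and]
      apply Finset.coe_injective
      rw [Finset.coe_image, Finset.coe_univ, Set.image_univ, hg'.range_comp,
        Finset.range_orderEmbOfFin]
    · intro g _ g' _ h
      exact (s.orderEmbOfFin rfl).injective.comp_left h
    · intro f hf
      have hf' : Finset.univ.image f = s := by simpa using hf
      have hr : Set.range f = s := by rw [← hf']; simp
      have hmem : ∀ v, ∃ i, s.orderEmbOfFin rfl i = f v := by
        intro v
        have : f v ∈ Set.range (s.orderEmbOfFin rfl) := by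
          rw [Finset.range_orderEmbOfFin, ← hr]; exact ⟨v, rfl⟩
        exact this
      choose g hg using hmem
      refine ⟨g, ?_, funext hg⟩
      simp only [Finset.mem_filter, Finset.mem_univ, true_and]
      intro i
      have : s.orderEmbOfFin rfl i ∈ Set.range f := by
        rw [hr]; exact Finset.orderEmbOfFin_mem s rfl i
      obtain ⟨v, hv⟩ := this
      exact ⟨v, (s.orderEmbOfFin rfl).injective ((hg v).trans hv)⟩
    · intro g _
      rw [ascents_comp, descents_comp]
  have hR : ∑ f : V → Fin q, y ^ D.ascents f * z ^ D.descents f =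
      ∑ p ∈ Finset.range (q + 1), (q.choose p : ℚ) * F p := by
    rw [← Finset.sum_fiberwise Finset.univ (fun f : V → Fin q => Finset.univ.image f)]
    simp only [hfib]
    have h := Finset.sum_powerset_apply_card F (x := (Finset.univ : Finset (Fin q)))
    simpa using h
  have hF0 : ∀ p, Fintype.card V < p → F p = 0 := by
    intro p hp
    apply Finset.sum_eq_zero
    intro g hg
    have hg' : Function.Surjective g := by simpa using hg
    have := Fintype.card_le_of_surjective g hg'
    simp at this
    omega
  rw [hL, hR]
  have h1 : ∀ N M : ℕ, N ≤ M → (∀ p, N < p → (q.choose p : ℚ) * F p = 0) →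
      ∑ p ∈ Finset.range (N + 1), (q.choose p : ℚ) * F p =
        ∑ p ∈ Finset.range (M + 1), (q.choose p : ℚ) * F p := by
    intro N M hNM h0
    apply Finset.sum_subset
    · intro p hp
      simp only [Finset.mem_range] at *
      omega
    · intro p _ hp
      apply h0
      simp only [Finset.mem_range] at hp
      omega
  rcases le_total (Fintype.card V) q with h | h
  · exact h1 _ _ h fun p hp => by rw [hF0 p hp, mul_zero]
  · exact (h1 _ _ h fun p hp => by rw [Nat.choose_eq_zero_of_lt hp]; simp).symm

open Classical in
/-- A polynomial is determined by its values at positive integers `q` and arbitrary `y, z`. -/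
theorem bPoly_unique [Fintype V] [Fintype A] (D : MultiDigraph V A) (P : MvPolynomial (Fin 3) ℚ)
    (hP : ∀ q : ℕ, 0 < q → ∀ y z : ℚ, MvPolynomial.eval ![(q : ℚ), y, z] P =
      ∑ f : V → Fin q, y ^ D.ascents f * z ^ D.descents f) : P = D.bPoly := by
  refine MvPolynomial.funext_set
    ![(fun n : ℕ => ((n + 1 : ℕ) : ℚ)) '' Set.univ, Set.univ, Set.univ] ?_ ?_
  · intro i
    fin_cases i
    · refine Set.infinite_univ.image ?_
      intro a _ b _ h
      have h' : ((a + 1 : ℕ) : ℚ) = ((b + 1 : ℕ) : ℚ) := h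
      have := Nat.cast_injective h'
      omega
    · exact Set.infinite_univ
    · exact Set.infinite_univ
  · intro x hx
    obtain ⟨n, -, hn⟩ : x 0 ∈ (fun n : ℕ => ((n + 1 : ℕ) : ℚ)) '' Set.univ := hx 0 (Set.mem_univ _)
    have hx' : x = ![((n + 1 : ℕ) : ℚ), x 1, x 2] := by
      ext i
      fin_cases i
      · exact hn.symm
      · rfl
      · rfl
    rw [hx', hP _ (Nat.succ_pos n), eval_bPoly]

/-- The number of connected components of the underlying undirected graph. -/
noncomputable def comp (D : MultiDigraph V A) : ℕ :=
  Nat.card (SimpleGraph.fromRel fun u v => ∃ a, D.origin a = u ∧ D.target a = v).ConnectedComponent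

/-- A directed cycle: a cyclic sequence of `n + 1 ≥ 1` arcs, each ending where the next one starts
(addition in `Fin (n + 1)` wraps around), without repeated vertices. A loop is a directed cycle. -/
def IsDirectedCycle (D : MultiDigraph V A) {n : ℕ} (c : Fin (n + 1) → A) : Prop :=
  Function.Injective (fun i => D.origin (c i)) ∧ ∀ i, D.target (c i) = D.origin (c (i + 1))

/-- Every arc lies in a directed cycle. -/
def IsTotallyCyclic (D : MultiDigraph V A) : Prop :=
  ∀ a : A, ∃ (n : ℕ) (c : Fin (n + 1) → A), D.IsDirectedCycle c ∧ a ∈ Set.range c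

end MultiDigraph

/-- A mixed graph: a digraph with a partition of its arc set into singletons (oriented edges) and
pairs of opposite arcs (unoriented edges). -/
structure MixedGraph (V A : Type*) [Fintype A] [DecidableEq A] extends MultiDigraph V A where
  edges : Finpartition (Finset.univ : Finset A)
  isEdge : ∀ e ∈ edges.parts, (∃ a, e = {a}) ∨
    ∃ a b, a ≠ b ∧ e = {a, b} ∧ origin b = target a ∧ target b = origin a

namespace MixedGraph

variable {V A : Type*} [Fintype V] [Fintype A] [DecidableEq A]

/-- The complete orientations of `D`, given by their arc sets: exactly one arc is kept from every
edge. The digraph itself is `D.restrict S`. -/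
def completeOrientations (D : MixedGraph V A) : Finset (Finset A) :=
  Finset.univ.filter fun S => ∀ e ∈ D.edges.parts, (S ∩ e).card = 1

/-- The field `ℚ(x, y)` of rational functions. -/
abbrev RatXY : Type := FractionRing (MvPolynomial (Fin 2) ℚ)

/-- The rational function `x`. -/
noncomputable def ratX : RatXY := algebraMap (MvPolynomial (Fin 2) ℚ) RatXY (MvPolynomial.X 0)

/-- The rational function `y`. -/
noncomputable def ratY : RatXY := algebraMap (MvPolynomial (Fin 2) ℚ) RatXY (MvPolynomial.X 1)

/-- The invariant `T⁽²⁾_D(x, y)`, as an element of `ℚ(x, y)`. -/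
noncomputable def tutteTwo (D : MixedGraph V A) : RatXY :=
  ratY ^ D.edges.parts.card /
      (2 ^ D.edges.parts.card * (ratY - 1) ^ Fintype.card V * (ratX - 1) ^ D.comp) *
    ∑ S ∈ D.completeOrientations,
      MvPolynomial.aeval ![(ratX - 1) * (ratY - 1), (2 - ratY) / ratY, 1] (D.restrict S).bPoly

/-- The rational function `r` is regular at the point `(x₀, y₀)`, with value `c` there: it is a
quotient of two polynomials whose denominator does not vanish at the point. -/
def HasValueAt (r : RatXY) (x₀ y₀ c : ℚ) : Prop :=
  ∃ f g : MvPolynomial (Fin 2) ℚ, MvPolynomial.eval ![x₀, y₀] g ≠ 0 ∧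
    r = algebraMap _ RatXY f / algebraMap _ RatXY g ∧
    c = MvPolynomial.eval ![x₀, y₀] f / MvPolynomial.eval ![x₀, y₀] g

/-- The value of a rational function at a point is unique. -/
theorem HasValueAt.unique {r : RatXY} {x₀ y₀ c c' : ℚ} (h : HasValueAt r x₀ y₀ c)
    (h' : HasValueAt r x₀ y₀ c') : c = c' := by
  obtain ⟨f, g, hg, hr, rfl⟩ := h
  obtain ⟨f', g', hg', hr', rfl⟩ := h'
  have inj : Function.Injective (algebraMap (MvPolynomial (Fin 2) ℚ) RatXY) :=
    IsFractionRing.injective _ _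
  have h0 : ∀ k : MvPolynomial (Fin 2) ℚ, MvPolynomial.eval ![x₀, y₀] k ≠ 0 →
      algebraMap (MvPolynomial (Fin 2) ℚ) RatXY k ≠ 0 := by
    intro k hk hk0
    rw [← map_zero (algebraMap (MvPolynomial (Fin 2) ℚ) RatXY)] at hk0
    rw [inj hk0] at hk
    simp at hk
  rw [hr, div_eq_div_iff (h0 g hg) (h0 g' hg'), ← map_mul, ← map_mul] at hr'
  have := congrArg (MvPolynomial.eval ![x₀, y₀]) (inj hr')
  rw [map_mul, map_mul] at this
  rwa [div_eq_div_iff hg hg']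

/-- For a polynomial, the value is the usual evaluation. -/
theorem hasValueAt_algebraMap_iff (P : MvPolynomial (Fin 2) ℚ) (x₀ y₀ c : ℚ) :
    HasValueAt (algebraMap _ RatXY P) x₀ y₀ c ↔ MvPolynomial.eval ![x₀, y₀] P = c := by
  have h : HasValueAt (algebraMap _ RatXY P) x₀ y₀ (MvPolynomial.eval ![x₀, y₀] P) :=
    ⟨P, 1, by simp, by simp, by simp⟩
  exact ⟨fun h' => h.unique h', fun h' => h' ▸ h⟩

end MixedGraph

/-! At `(x, y) = (0, 2)` the arguments of `B` are `(-1, 0, 1)` and the prefactor is `(-1) ^ c(D)`.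
All complete orientations have the components of `D` (`comp_restrict`), so it suffices that `B_D(-1,
0, 1)` is `(-1) ^ c(D)` for totally cyclic `D` and `0` otherwise (`eval_bPoly_neg_one_zero_one`).

For natural `q`, `B_D(q, 0, 1)` counts the `q`-colorings without ascents. Let `T` be a set of
vertices from which all others are reachable. A descending `(q + 1)`-coloring avoids the top color
as soon as it does so on `T`, and giving `B ⊆ T` the top color forces it on all ancestors of `B`.
Inclusion–exclusion (`card_descending`) expresses `B_D(q, 0, 1)` through the values at `q + 1` of
the digraphs left after deleting the ancestors. At `q = -1` these are values at `0`, which vanish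
unless no vertex is left. If `T` is also independent under reachability, only `B = T` can survive,
and it does exactly when `D` is totally cyclic; then `T` has one vertex per component. -/

namespace MultiDigraph

variable {V A : Type*}

/-- The vertex `v` can be reached from `u` along a directed walk. -/
def Reaches (D : MultiDigraph V A) : V → V → Prop :=
  Relation.ReflTransGen fun u v => ∃ a, D.origin a = u ∧ D.target a = v

/-- The subdigraph induced on the complement of `U`. -/
def deleteVerts (D : MultiDigraph V A) (U : Set V) :
    MultiDigraph {v // v ∉ U} {a // D.origin a ∉ U ∧ D.target a ∉ U} where
  origin a := ⟨D.origin a, a.2.1⟩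
  target a := ⟨D.target a, a.2.2⟩

/-- A coloring that has no ascents. -/
def IsDescending {C : Type*} [LinearOrder C] (D : MultiDigraph V A) (f : V → C) : Prop :=
  ∀ a, f (D.target a) ≤ f (D.origin a)

lemma ascents_eq_zero_iff [Fintype A] {C : Type*} [LinearOrder C] (D : MultiDigraph V A)
    (f : V → C) : D.ascents f = 0 ↔ D.IsDescending f := by
  simp [ascents, IsDescending, Finset.filter_eq_empty_iff]

lemma IsDescending.le_of_reaches {C : Type*} [LinearOrder C] {D : MultiDigraph V A} {f : V → C}
    (hf : D.IsDescending f) {u v : V} (h : D.Reaches u v) : f v ≤ f u := by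
  induction h with
  | refl => exact le_rfl
  | tail _ h ih =>
    obtain ⟨a, rfl, rfl⟩ := h
    exact (hf a).trans ih

lemma eval_bPoly_zero_one [Fintype V] [Fintype A] (D : MultiDigraph V A) (q : ℕ) :
    MvPolynomial.eval ![(q : ℚ), 0, 1] D.bPoly = Nat.card {f : V → Fin q // D.IsDescending f} := by
  classical
  rw [eval_bPoly]
  simp only [one_pow, mul_one, zero_pow_eq, ascents_eq_zero_iff]
  rw [Nat.card_eq_fintype_card, Fintype.card_subtype, Finset.sum_boole]

/-! ### Inclusion–exclusion on the top color -/

/-- The vertices from which some vertex of `T` can be reached. -/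
def ancestors (D : MultiDigraph V A) (T : Finset V) : Set V := {v | ∃ t ∈ T, D.Reaches v t}

/-- Descending colorings with the top color on `T` correspond to descending colorings of the
digraph without the ancestors of `T`. -/
noncomputable def descendingTopEquiv (D : MultiDigraph V A) (T : Finset V) (q : ℕ) :
    {f : {f : V → Fin (q + 1) // D.IsDescending f} // ∀ t ∈ T, f.1 t = Fin.last q} ≃
      {g : {v // v ∉ D.ancestors T} → Fin (q + 1) //
        (D.deleteVerts (D.ancestors T)).IsDescending g} := by
  classical
  exact
  { toFun := fun f => ⟨fun v => f.1.1 v, fun a => f.1.2 a⟩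
    invFun := fun g => ⟨⟨fun v => if h : v ∈ D.ancestors T then Fin.last q else g.1 ⟨v, h⟩, by
      intro a
      by_cases ho : D.origin a ∈ D.ancestors T
      · simp [ho, Fin.le_last]
      -- Ancestor sets are closed under predecessors, so no arc leads from outside into one.
      · have ht : D.target a ∉ D.ancestors T := fun ⟨t, ht, h⟩ =>
          ho ⟨t, ht, Relation.ReflTransGen.head ⟨a, rfl, rfl⟩ h⟩
        simp only [ho, ht, dite_false]
        exact g.2 ⟨a, ho, ht⟩⟩, by
      intro t ht
      have : t ∈ D.ancestors T := ⟨t, ht, Relation.ReflTransGen.refl⟩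
      simp [this]⟩
    left_inv := by
      rintro ⟨⟨f, hf⟩, h⟩
      ext v : 3
      by_cases hv : v ∈ D.ancestors T
      · obtain ⟨t, ht, hvt⟩ := id hv
        have : Fin.last q ≤ f v := (h t ht).symm.le.trans (hf.le_of_reaches hvt)
        simp [hv, Fin.last_le_iff.mp this]
      · simp [hv]
    right_inv := by
      rintro ⟨g, hg⟩
      ext ⟨v, hv⟩ : 2
      simp [hv] }

/-- Descending colorings that avoid the top color are descending colorings with one color less. -/
def descendingAvoidTopEquiv (D : MultiDigraph V A) (q : ℕ) :
    {f : {f : V → Fin (q + 1) // D.IsDescending f} // ∀ v, f.1 v ≠ Fin.last q} ≃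
      {g : V → Fin q // D.IsDescending g} where
  toFun f := ⟨fun v => (f.1.1 v).castPred (f.2 v), fun a => by
    simpa using f.1.2 a⟩
  invFun g := ⟨⟨fun v => (g.1 v).castSucc, fun a => by simpa using g.2 a⟩,
    fun v => (Fin.castSucc_lt_last _).ne⟩
  left_inv f := by ext; simp
  right_inv g := by ext; simp

/-- Inclusion–exclusion over the vertices of a generating set `T` that get the top color. -/
lemma card_descending [Fintype V] [Fintype A] (D : MultiDigraph V A) (T : Finset V)
    (hT : ∀ v, ∃ t ∈ T, D.Reaches t v) (q : ℕ) :
    (Nat.card {f : V → Fin q // D.IsDescending f} : ℤ) =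
      ∑ B ∈ T.powerset, (-1 : ℤ) ^ B.card *
        Nat.card {g : {v // v ∉ D.ancestors B} → Fin (q + 1) //
          (D.deleteVerts (D.ancestors B)).IsDescending g} := by
  classical
  have key := Finset.inclusion_exclusion_card_inf_compl T
    fun t => (Finset.univ.filter fun f : {f : V → Fin (q + 1) // D.IsDescending f} =>
      f.1 t = Fin.last q)
  have hL : Nat.card {f : V → Fin q // D.IsDescending f} =
      (T.inf fun t => (Finset.univ.filter fun f : {f : V → Fin (q + 1) // D.IsDescending f} =>
        f.1 t = Fin.last q)ᶜ).card := by
    rw [← Nat.card_congr (D.descendingAvoidTopEquiv q), Nat.card_eq_fintype_card,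
      Fintype.card_subtype]
    congr 1
    ext f
    simp only [Finset.mem_filter, Finset.mem_univ, true_and, Finset.mem_inf, Finset.mem_compl]
    -- A top-colored `v` makes any generator reaching it top-colored as well.
    refine ⟨fun h t _ => h t, fun h v hv => ?_⟩
    obtain ⟨t, ht, htv⟩ := hT v
    have := f.2.le_of_reaches htv
    rw [hv] at this
    exact h t ht (Fin.last_le_iff.mp this)
  rw [hL, key]
  refine Finset.sum_congr rfl fun B _ => ?_
  rw [← Nat.card_congr (D.descendingTopEquiv B q), Nat.card_eq_fintype_card, Fintype.card_subtype]
  congr 3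
  ext f
  simp [Finset.mem_inf]

/-- Specializing the last two variables first and the first one afterwards. -/
lemma eval_aeval_X (P : MvPolynomial (Fin 3) ℚ) (y z t : ℚ) :
    (MvPolynomial.aeval ![(Polynomial.X : Polynomial ℚ), Polynomial.C y, Polynomial.C z] P).eval t =
      MvPolynomial.eval ![t, y, z] P := by
  rw [← Polynomial.coe_evalRingHom, ← MvPolynomial.coe_aeval_eq_eval, MvPolynomial.aeval_def,
    MvPolynomial.hom_eval₂, RingHom.coe_coe, MvPolynomial.aeval_def]
  congr 1
  · exact Subsingleton.elim _ _
  · ext i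
    fin_cases i <;> simp

/-- The recursion between `q` and `q + 1` holds at all naturals, hence as an identity of polynomials
in `q`. Substituting `-1` leaves zero colors, for which only the empty digraph has a coloring. -/
lemma eval_bPoly_neg_one [Fintype V] [Fintype A] (D : MultiDigraph V A) (T : Finset V)
    (hT : ∀ v, ∃ t ∈ T, D.Reaches t v) :
    open Classical in
    MvPolynomial.eval ![(-1 : ℚ), 0, 1] D.bPoly =
      ∑ B ∈ T.powerset, if D.ancestors B = Set.univ then (-1 : ℚ) ^ B.card else 0 := by
  classical
  let spec : MvPolynomial (Fin 3) ℚ →ₐ[ℚ] Polynomial ℚ :=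
    MvPolynomial.aeval ![Polynomial.X, Polynomial.C 0, Polynomial.C 1]
  have hpoly : spec D.bPoly = ∑ B ∈ T.powerset, (-1 : Polynomial ℚ) ^ B.card *
      (spec (D.deleteVerts (D.ancestors B)).bPoly).comp (Polynomial.X + 1) := by
    refine Polynomial.eq_of_infinite_eval_eq _ _ ?_
    refine (Set.infinite_range_of_injective (Nat.cast_injective (R := ℚ))).mono ?_
    rintro _ ⟨q, rfl⟩
    have h := congrArg (Int.cast : ℤ → ℚ) (D.card_descending T hT q)
    push_cast at h
    simp only [Set.mem_ofPred_eq, Polynomial.eval_finsetSum, Polynomial.eval_mul,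
      Polynomial.eval_pow, Polynomial.eval_neg, Polynomial.eval_one, Polynomial.eval_comp,
      Polynomial.eval_add, Polynomial.eval_X, spec, eval_aeval_X]
    rw [eval_bPoly_zero_one, h]
    refine Finset.sum_congr rfl fun B _ => ?_
    rw [← eval_bPoly_zero_one]
    push_cast
    rfl
  have h := congrArg (Polynomial.eval (-1)) hpoly
  simp only [Polynomial.eval_finsetSum, Polynomial.eval_mul,
      Polynomial.eval_pow, Polynomial.eval_neg, Polynomial.eval_one, Polynomial.eval_comp,
      Polynomial.eval_add, Polynomial.eval_X, spec, eval_aeval_X] at h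
  rw [h]
  refine Finset.sum_congr rfl fun B _ => ?_
  have h0 := (D.deleteVerts (D.ancestors B)).eval_bPoly_zero_one 0
  rw [Nat.cast_zero] at h0
  rw [neg_add_cancel, h0]
  split_ifs with hB
  · have : IsEmpty {v // v ∉ D.ancestors B} := ⟨fun v => v.2 (Set.eq_univ_iff_forall.mp hB v)⟩
    have : Unique {g : {v // v ∉ D.ancestors B} → Fin 0 //
        (D.deleteVerts (D.ancestors B)).IsDescending g} :=
      { default := ⟨isEmptyElim, fun a => isEmptyElim ((D.deleteVerts _).origin a)⟩
        uniq := fun g => Subtype.ext (Subsingleton.elim _ _) }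
    simp
  · obtain ⟨v, hv⟩ := (Set.ne_univ_iff_exists_notMem _).mp hB
    have : IsEmpty {g : {v // v ∉ D.ancestors B} → Fin 0 //
        (D.deleteVerts (D.ancestors B)).IsDescending g} := ⟨fun g => (g.1 ⟨v, hv⟩).elim0⟩
    simp

/-! ### Total cyclicity in terms of reachability -/

lemma exists_walk_of_reaches (D : MultiDigraph V A) (a : A) {v : V}
    (h : D.Reaches (D.target a) v) : ∃ (n : ℕ) (w : ℕ → A), w 0 = a ∧
      (∀ i < n, D.target (w i) = D.origin (w (i + 1))) ∧ D.target (w n) = v := by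
  induction h with
  | refl => exact ⟨0, fun _ => a, rfl, by simp, rfl⟩
  | tail _ h ih =>
    obtain ⟨b, hb, rfl⟩ := h
    obtain ⟨n, w, h0, hw, hn⟩ := ih
    refine ⟨n + 1, fun i => if i ≤ n then w i else b, by simp [h0], fun i hi => ?_, by simp⟩
    rcases Nat.lt_succ_iff_lt_or_eq.mp hi with hi | rfl
    · simp [hi.le, Nat.succ_le_of_lt hi, hw i hi]
    · simp [hn, hb]

/-- A shortest closed walk starting with `a` repeats no vertex. -/
lemma exists_directedCycle_of_reaches (D : MultiDigraph V A) (a : A)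
    (h : D.Reaches (D.target a) (D.origin a)) :
    ∃ (n : ℕ) (c : Fin (n + 1) → A), D.IsDirectedCycle c ∧ a ∈ Set.range c := by
  classical
  have hex := D.exists_walk_of_reaches a h
  obtain ⟨w, h0, hw, hn⟩ := Nat.find_spec hex
  have hmin := fun m (hm : m < Nat.find hex) => Nat.find_min hex hm
  generalize Nat.find hex = n at *
  have hinj : ∀ i j, i < j → j ≤ n → D.origin (w i) ≠ D.origin (w j) := by
    intro i j hij hj heq
    -- The shortened walk must still begin with `a`: if `i = 0`, stop before arc `j`; otherwise
    -- splice out the arcs `i, …, j - 1`.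
    rcases Nat.eq_zero_or_pos i with rfl | hi
    · refine hmin (j - 1) (by omega) ⟨w, h0, fun k hk => hw k (by omega), ?_⟩
      rw [hw (j - 1) (by omega), Nat.sub_add_cancel hij, ← heq, h0]
    · refine hmin (n - (j - i)) (by omega)
        ⟨fun k => if k < i then w k else w (k + (j - i)), by simp [hi, h0], fun k hk => ?_, ?_⟩
      · rcases lt_trichotomy (k + 1) i with hk' | hk' | hk'
        · simp [hk', (Nat.lt_succ_self k).trans hk', hw k (by omega)]
        · have e : k + 1 + (j - i) = j := by omega
          have : k < i := by omega
          simp only [this, if_true, hk', lt_irrefl, if_false]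
          rw [hw k (by omega), hk', heq]
          congr 2
          omega
        · have h1 : ¬ k < i := by omega
          have h2 : ¬ k + 1 < i := by omega
          simp only [h1, h2, if_false]
          rw [hw _ (by omega)]
          congr 2
          omega
      · have h1 : ¬ n - (j - i) < i := by omega
        simp only [h1, if_false]
        rw [Nat.sub_add_cancel (by omega), hn]
  refine ⟨n, fun i => w i, ⟨fun i j hij => ?_, fun i => ?_⟩, 0, by simp [h0]⟩
  · rcases lt_trichotomy (i : ℕ) j with hlt | heq | hlt
    · exact absurd hij (hinj _ _ hlt (by omega))
    · exact Fin.ext heq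
    · exact absurd hij.symm (hinj _ _ hlt (by omega))
  · rcases eq_or_ne i (Fin.last n) with rfl | hi
    · simp [hn, h0]
    · have hlt : i < Fin.last n := Fin.lt_last_iff_ne_last.mpr hi
      have := hw i hlt
      rwa [← Fin.val_add_one_of_lt hlt] at this

lemma IsDirectedCycle.reaches {D : MultiDigraph V A} {n : ℕ} {c : Fin (n + 1) → A}
    (hc : D.IsDirectedCycle c) (i : Fin (n + 1)) :
    D.Reaches (D.target (c i)) (D.origin (c i)) := by
  have key : ∀ k : Fin (n + 1), D.Reaches (D.target (c i)) (D.origin (c (i + 1 + k))) := by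
    intro k
    induction k using Fin.induction with
    | zero =>
      rw [add_zero, ← hc.2 i]
      exact Relation.ReflTransGen.refl
    | succ k ih =>
      refine ih.tail ⟨_, rfl, ?_⟩
      rw [hc.2, ← Fin.coeSucc_eq_succ, add_assoc (i + 1)]
  -- `i + 1 + n` wraps around to `i`.
  have := key (Fin.last n)
  rwa [add_assoc, add_comm 1, Fin.last_add_one, add_zero] at this

lemma isTotallyCyclic_iff_reaches (D : MultiDigraph V A) :
    D.IsTotallyCyclic ↔ ∀ a, D.Reaches (D.target a) (D.origin a) := by
  refine ⟨fun h a => ?_, fun h a => D.exists_directedCycle_of_reaches a (h a)⟩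
  obtain ⟨n, c, hc, i, rfl⟩ := h a
  exact hc.reaches i

lemma IsTotallyCyclic.reaches_symm {D : MultiDigraph V A} (hD : D.IsTotallyCyclic) {u v : V}
    (h : D.Reaches u v) : D.Reaches v u := by
  induction h with
  | refl => exact Relation.ReflTransGen.refl
  | tail _ h ih =>
    obtain ⟨a, rfl, rfl⟩ := h
    exact (D.isTotallyCyclic_iff_reaches.mp hD a).trans ih

/-! ### Independent generators and connected components -/

/-- There is a set of pairwise unreachable vertices from which every vertex can be reached. -/
lemma exists_independent_generators [Fintype V] (D : MultiDigraph V A) :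
    ∃ T : Finset V, (∀ v, ∃ t ∈ T, D.Reaches t v) ∧
      ∀ s ∈ T, ∀ t ∈ T, D.Reaches s t → s = t := by
  classical
  obtain ⟨T, hT, hmin⟩ := Finset.exists_min_image
    (Finset.univ.filter fun T : Finset V => ∀ v, ∃ t ∈ T, D.Reaches t v) Finset.card
    ⟨Finset.univ, by
      simp only [Finset.mem_filter, Finset.mem_univ, true_and]
      exact fun v => ⟨v, Relation.ReflTransGen.refl⟩⟩
  simp only [Finset.mem_filter, Finset.mem_univ, true_and] at hT hmin
  refine ⟨T, hT, fun s hs t ht hst => ?_⟩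
  -- If `s` reaches `t ≠ s`, then `t` is redundant, contradicting minimal cardinality.
  by_contra hne
  refine (Finset.card_erase_lt_of_mem ht).not_ge (hmin (T.erase t) fun v => ?_)
  obtain ⟨r, hr, hrv⟩ := hT v
  rcases eq_or_ne r t with rfl | hrt
  · exact ⟨s, Finset.mem_erase.mpr ⟨hne, hs⟩, hst.trans hrv⟩
  · exact ⟨r, Finset.mem_erase.mpr ⟨hrt, hr⟩, hrv⟩

/-- For an arc `u → v`, some `s ∈ T` reaches `u` and `v` reaches some `t ∈ T`; independence gives `s
= t`, which closes the walk from `v` back to `u`. -/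
lemma ancestors_eq_univ_iff (D : MultiDigraph V A) {T : Finset V}
    (hT : ∀ v, ∃ t ∈ T, D.Reaches t v) (hind : ∀ s ∈ T, ∀ t ∈ T, D.Reaches s t → s = t) :
    D.ancestors T = Set.univ ↔ D.IsTotallyCyclic := by
  rw [isTotallyCyclic_iff_reaches]
  constructor
  · intro h a
    obtain ⟨s, hs, hsu⟩ := hT (D.origin a)
    obtain ⟨t, ht, hvt⟩ : D.target a ∈ D.ancestors T := h ▸ Set.mem_univ _
    have hst : s = t := hind s hs t ht
      ((hsu.tail ⟨a, rfl, rfl⟩).trans hvt)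
    subst hst
    exact hvt.trans hsu
  · intro h
    refine Set.eq_univ_of_forall fun v => ?_
    obtain ⟨t, ht, htv⟩ := hT v
    exact ⟨t, ht, IsTotallyCyclic.reaches_symm (D.isTotallyCyclic_iff_reaches.mpr h) htv⟩

lemma IsTotallyCyclic.reaches_iff_reachable {D : MultiDigraph V A} (hD : D.IsTotallyCyclic)
    (u v : V) : D.Reaches u v ↔ (SimpleGraph.fromRel fun u v =>
      ∃ a, D.origin a = u ∧ D.target a = v).Reachable u v := by
  constructor
  · intro h
    induction h with
    | refl => exact SimpleGraph.Reachable.refl _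
    | @tail b c _ h ih =>
      rcases eq_or_ne b c with rfl | hne
      · exact ih
      · exact ih.trans (SimpleGraph.Adj.reachable
          ((SimpleGraph.fromRel_adj _ _ _).mpr ⟨hne, Or.inl h⟩))
  · intro h
    rw [SimpleGraph.reachable_iff_reflTransGen] at h
    induction h with
    | refl => exact Relation.ReflTransGen.refl
    | tail _ h ih =>
      refine ih.trans ?_
      rcases ((SimpleGraph.fromRel_adj _ _ _).mp h).2 with h | h
      · exact Relation.ReflTransGen.single h
      · exact hD.reaches_symm (Relation.ReflTransGen.single h)

lemma IsTotallyCyclic.comp_eq_card {D : MultiDigraph V A} (hD : D.IsTotallyCyclic) {T : Finset V}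
    (hT : ∀ v, ∃ t ∈ T, D.Reaches t v) (hind : ∀ s ∈ T, ∀ t ∈ T, D.Reaches s t → s = t) :
    D.comp = T.card := by
  rw [comp, ← Nat.card_eq_finsetCard T]
  refine (Nat.card_eq_of_bijective (fun t : T => SimpleGraph.connectedComponentMk _ t.1)
    ⟨fun s t hst => ?_, fun C => ?_⟩).symm
  · exact Subtype.ext (hind s s.2 t t.2
      ((hD.reaches_iff_reachable s t).mpr (SimpleGraph.ConnectedComponent.exact hst)))
  · induction C using SimpleGraph.ConnectedComponent.ind with
    | h v =>
      obtain ⟨t, ht, htv⟩ := hT v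
      exact ⟨⟨t, ht⟩,
        SimpleGraph.ConnectedComponent.sound ((hD.reaches_iff_reachable t v).mp htv)⟩

/-- The value of `B_D(q, 0, 1)` at `q = -1`. -/
theorem eval_bPoly_neg_one_zero_one [Fintype V] [Fintype A] (D : MultiDigraph V A) :
    open Classical in
    MvPolynomial.eval ![(-1 : ℚ), 0, 1] D.bPoly =
      if D.IsTotallyCyclic then (-1 : ℚ) ^ D.comp else 0 := by
  classical
  obtain ⟨T, hT, hind⟩ := D.exists_independent_generators
  rw [D.eval_bPoly_neg_one T hT, Finset.sum_eq_single T]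
  · simp only [D.ancestors_eq_univ_iff hT hind]
    split_ifs with h
    · rw [h.comp_eq_card hT hind]
    · rfl
  · intro B hB hne
    refine if_neg fun h => hne ?_
    -- Each `t ∈ T` reaches some element of `B ⊆ T`, which by independence is `t` itself.
    refine (Finset.mem_powerset.mp hB).antisymm fun t ht => ?_
    obtain ⟨s, hs, hts⟩ : t ∈ D.ancestors B := h ▸ Set.mem_univ _
    rwa [hind t ht s (Finset.mem_powerset.mp hB hs) hts]
  · simp

end MultiDigraph

namespace MixedGraph

/-! ### Arithmetic of values of rational functions -/

namespace HasValueAt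

variable {r s : RatXY} {x₀ y₀ c d : ℚ}

lemma algebraMap_ne_zero {g : MvPolynomial (Fin 2) ℚ} (hg : MvPolynomial.eval ![x₀, y₀] g ≠ 0) :
    algebraMap (MvPolynomial (Fin 2) ℚ) RatXY g ≠ 0 := by
  intro h
  rw [FaithfulSMul.algebraMap_eq_zero_iff] at h
  simp [h] at hg

lemma add (hr : HasValueAt r x₀ y₀ c) (hs : HasValueAt s x₀ y₀ d) :
    HasValueAt (r + s) x₀ y₀ (c + d) := by
  obtain ⟨f, g, hg, rfl, rfl⟩ := hr
  obtain ⟨f', g', hg', rfl, rfl⟩ := hs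
  refine ⟨f * g' + g * f', g * g', by simp [hg, hg'], ?_, ?_⟩
  · rw [div_add_div _ _ (algebraMap_ne_zero hg) (algebraMap_ne_zero hg')]
    simp
  · rw [div_add_div _ _ hg hg']
    simp

lemma mul (hr : HasValueAt r x₀ y₀ c) (hs : HasValueAt s x₀ y₀ d) :
    HasValueAt (r * s) x₀ y₀ (c * d) := by
  obtain ⟨f, g, hg, rfl, rfl⟩ := hr
  obtain ⟨f', g', hg', rfl, rfl⟩ := hs
  exact ⟨f * f', g * g', by simp [hg, hg'], by simp [div_mul_div_comm],
    by simp [div_mul_div_comm]⟩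

lemma sum {ι : Type*} (t : Finset ι) {r : ι → RatXY} {c : ι → ℚ}
    (h : ∀ i ∈ t, HasValueAt (r i) x₀ y₀ (c i)) :
    HasValueAt (∑ i ∈ t, r i) x₀ y₀ (∑ i ∈ t, c i) := by
  classical
  induction t using Finset.induction_on with
  | empty => exact ⟨0, 1, by simp, by simp, by simp⟩
  | insert i t hi ih =>
    rw [Finset.sum_insert hi, Finset.sum_insert hi]
    exact (h i (Finset.mem_insert_self _ _)).add
      (ih fun j hj => h j (Finset.mem_insert_of_mem hj))

lemma aeval {σ : Type*} {r : σ → RatXY} {c : σ → ℚ} (h : ∀ i, HasValueAt (r i) x₀ y₀ (c i))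
    (P : MvPolynomial σ ℚ) :
    HasValueAt (MvPolynomial.aeval r P) x₀ y₀ (MvPolynomial.eval c P) := by
  induction P using MvPolynomial.induction_on with
  | C a =>
    refine ⟨MvPolynomial.C a, 1, by simp, ?_, by simp⟩
    rw [MvPolynomial.aeval_C, map_one, div_one, ← MvPolynomial.algebraMap_eq,
      ← IsScalarTower.algebraMap_apply]
  | add p q hp hq => simpa using hp.add hq
  | mul_X p i hp => simpa using hp.mul (h i)

end HasValueAt

variable {V A : Type*} [Fintype A] [DecidableEq A]

/-! ### Passage to mixed graphs -/

/-- A complete orientation has the same connected components as the mixed graph. -/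
lemma comp_restrict (D : MixedGraph V A) {S : Finset A} (hS : S ∈ D.completeOrientations) :
    (D.restrict S).comp = D.comp := by
  have hS' : ∀ e ∈ D.edges.parts, (S ∩ e).card = 1 := by
    simpa [completeOrientations] using hS
  have key : ∀ a : A, ∃ b ∈ S, (D.origin b = D.origin a ∧ D.target b = D.target a) ∨
      (D.origin b = D.target a ∧ D.target b = D.origin a) := by
    intro a
    obtain ⟨e, he, hae⟩ := D.edges.exists_mem (Finset.mem_univ a)
    obtain ⟨b, hb⟩ := Finset.card_pos.mp ((hS' e he).symm ▸ Nat.one_pos)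
    obtain ⟨hbS, hbe⟩ := Finset.mem_inter.mp hb
    refine ⟨b, hbS, ?_⟩
    rcases D.isEdge e he with ⟨a', rfl⟩ | ⟨a', b', -, rfl, h1, h2⟩
    · simp only [Finset.mem_singleton] at hae hbe
      simp [hae, hbe]
    · simp only [Finset.mem_insert, Finset.mem_singleton] at hae hbe
      rcases hae with rfl | rfl <;> rcases hbe with rfl | rfl <;> simp [h1, h2]
  unfold MultiDigraph.comp
  congr 2
  ext u v
  simp only [SimpleGraph.fromRel_adj, MultiDigraph.restrict]
  refine and_congr_right fun _ => ⟨?_, ?_⟩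
  · rintro (⟨a, h⟩ | ⟨a, h⟩)
    · exact Or.inl ⟨a, h⟩
    · exact Or.inr ⟨a, h⟩
  · rintro (⟨a, rfl, rfl⟩ | ⟨a, rfl, rfl⟩) <;> obtain ⟨b, hb, h | h⟩ := key a
    · exact Or.inl ⟨⟨b, hb⟩, h⟩
    · exact Or.inr ⟨⟨b, hb⟩, h⟩
    · exact Or.inr ⟨⟨b, hb⟩, h⟩
    · exact Or.inl ⟨⟨b, hb⟩, h⟩

end MixedGraph

open MixedGraph in
theorem corollary7p4 {V A : Type*} [Fintype V] [Fintype A] [DecidableEq A] (D : MixedGraph V A) :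
    MixedGraph.HasValueAt D.tutteTwo 0 2
      ({S : Finset A | S ∈ D.completeOrientations ∧ (D.restrict S).IsTotallyCyclic}.ncard : ℚ) := by
  classical
  have hpre : HasValueAt (ratY ^ D.edges.parts.card /
      (2 ^ D.edges.parts.card * (ratY - 1) ^ Fintype.card V * (ratX - 1) ^ D.comp)) 0 2
      ((-1) ^ D.comp) := by
    refine ⟨MvPolynomial.X 1 ^ D.edges.parts.card, 2 ^ D.edges.parts.card *
      (MvPolynomial.X 1 - 1) ^ Fintype.card V * (MvPolynomial.X 0 - 1) ^ D.comp, ?_, ?_, ?_⟩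
    · norm_num
    · simp [ratX, ratY, map_ofNat]
    -- The powers of `2` cancel, and `(-1) ^ c` is its own inverse.
    · rcases neg_one_pow_eq_or ℚ D.comp with h | h <;> norm_num [h]
  have hval : ∀ S ∈ D.completeOrientations, HasValueAt (MvPolynomial.aeval
      ![(ratX - 1) * (ratY - 1), (2 - ratY) / ratY, 1] (D.restrict S).bPoly) 0 2
      (MvPolynomial.eval ![(-1 : ℚ), 0, 1] (D.restrict S).bPoly) := by
    intro S _
    refine HasValueAt.aeval (fun i => ?_) _
    fin_cases i
    · exact ⟨(MvPolynomial.X 0 - 1) * (MvPolynomial.X 1 - 1), 1, by simp, by simp [ratX, ratY],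
        by norm_num⟩
    · exact ⟨2 - MvPolynomial.X 1, MvPolynomial.X 1, by simp, by simp [ratY, map_ofNat], by norm_num⟩
    · exact ⟨1, 1, by simp, by simp, by simp⟩
  have h := hpre.mul (HasValueAt.sum _ hval)
  rw [tutteTwo]
  convert h using 1
  have hset : {S : Finset A | S ∈ D.completeOrientations ∧ (D.restrict S).IsTotallyCyclic} =
      (D.completeOrientations.filter fun S => (D.restrict S).IsTotallyCyclic : Set (Finset A)) := by
    ext S
    simp
  rw [hset, Set.ncard_coe_finset, Finset.card_filter, Finset.mul_sum]
  push_cast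
  refine Finset.sum_congr rfl fun S hS => ?_
  rw [MultiDigraph.eval_bPoly_neg_one_zero_one, D.comp_restrict hS]
  split_ifs
  · rw [← mul_pow]
    simp
  · simp
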